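/- Let $\ell\ge 2$ and $0\le i\le \ell$. Consider the array with $2\ell-1$ rows in which rows of odd and rows of even positive integers alternate, the first and last rows being odd ($1,3,5,\dots$) if $i$ is odd and even ($2,4,6,\dots$) if $i$ is even. The entry $m$ of a row is placed in column $m$; equal integers in different rows are regarded as different (differently colored) parts. In addition each row has one initial position to the left of its parts, in column $-1$ for an odd row and in column $0$ for an even row. A colored partition is a finite multiset of parts of the array; its frequency array has at the position of each part the multiplicity of that part, and at the initial positions the entry $1$ in row $\max(i,1)$ and $0$ in all other rows (that is, $k_i=1$, where $k_0$ stands at the left end of row $1$ and $k_i$, $i\ge 1$, at the left end of row $i$, and all other $k_j$ are $0$). A downward path consists of one position in each row, from the first row to the last, where from column $c$ of a row one moves to column $c-1$ or $c+1$ of the next row. The colored partition is admissible if along every downward path the sum of the entries of its frequency array is at most $k=1$. Let $F^\star(i,j,n)$ be the number of admissible colored partitions of $n$ with exactly $j$ parts, and let $$P^\star_i(z,q)=\sum_{n,j\ge 0}F^\star(i,j,n)\,z^jq^n .$$ Then, as formal power series in $z$ and $q$, $$P^\star_i(z,q)=\sum_{n_1,n_2,\dots,n_{\ell}\ge 0}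 \frac{z^{n_1+n_2+\cdots+n_{\ell}}\,q^{N_1^2+N_2^2+\cdots+N_{\ell}^2+N_{i+1}+N_{i+2}+\cdots+N_{\ell}}}{(q;q)_{n_1}(q;q)_{n_2}\cdots(q;q)_{n_{\ell-1}}\,(q^2;q^2)_{n_{\ell}}},$$ where $N_m=n_m+n_{m+1}+\cdots+n_\ell$ and $(a;b)_n=\prod_{j=1}^n(1-ab^{j-1})$. -/

import Mathlib

open scoped PowerSeries PowerSeries.WithPiTopology

namespace CMPP

/-! ### The arrays with `2ℓ - 1` rows

Rows are numbered `1, …, 2ℓ - 1` from the top. An array is given by its least part `t` in the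
first row: for `t = 1` the first and last rows consist of the odd positive integers, for `t = 2`
of the even positive integers; in both cases odd and even rows alternate. An entry of the array is
addressed by its row `r` and its column `c : ℤ`. The part with value `c ≥ 1` stands in column `c`.
To the left of the parts there is one additional entry in each row, the initial condition: in column
`-1` for a row of odd integers and in column `0` for a row of even integers. Thus all columns of
row `r` have the same parity as `t + r - 1`. -/

/-- `(r, c)` is a position of the array with `2ℓ - 1` rows (initial positions included). -/
def IsPosition (t ℓ r : ℕ) (c : ℤ) : Prop :=
  1 ≤ r ∧ r ≤ 2 * ℓ - 1 ∧ -1 ≤ c ∧ Odd (c + t + r)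

/-- The (colored) parts: `(r, m)` is the positive integer `m` in row `r`; equal integers in
different rows are different parts. -/
def IsPart (t ℓ : ℕ) (p : ℕ × ℕ) : Prop :=
  1 ≤ p.2 ∧ IsPosition t ℓ p.1 p.2

/-- The initial condition at the left end of row `r`. In a row of odd integers (`t + r` even) it is
`k r` as long as `r ≤ ℓ`; if the first row consists of even integers, then `k 0` stands at its left
end. All the other entries are `0`. -/
def initialEntry (t ℓ : ℕ) (k : ℕ → ℕ) (r : ℕ) : ℕ :=
  if Even (t + r) then (if r ≤ ℓ then k r else 0)
  else if r = 1 then k 0 else 0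

/-- The frequency array of a colored partition `π` (a multiset of parts), with the initial
conditions at the left end. -/
def entry (t ℓ : ℕ) (k : ℕ → ℕ) (π : Multiset (ℕ × ℕ)) (r : ℕ) (c : ℤ) : ℕ :=
  if c ≤ 0 then initialEntry t ℓ k r else π.count (r, c.toNat)

/-- A downward path: it picks one position `(r, Z r)` in each row, from the first to the last
row, moving from each row to one of the two diagonally adjacent positions of the next row. -/
def IsDownwardPath (t ℓ : ℕ) (Z : ℕ → ℤ) : Prop :=
  (∀ r, 1 ≤ r → r ≤ 2 * ℓ - 1 → IsPosition t ℓ r (Z r)) ∧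
  ∀ r, 1 ≤ r → r + 1 ≤ 2 * ℓ - 1 → (Z (r + 1) = Z r + 1 ∨ Z (r + 1) = Z r - 1)

/-- `[k 0, …, k ℓ]`-admissible colored partitions. -/
def IsAdmissible (t ℓ : ℕ) (k : ℕ → ℕ) (π : Multiset (ℕ × ℕ)) : Prop :=
  (∀ p ∈ π, IsPart t ℓ p) ∧
  ∀ Z : ℕ → ℤ, IsDownwardPath t ℓ Z →
    ∑ r ∈ Finset.Icc 1 (2 * ℓ - 1), entry t ℓ k π r (Z r) ≤ ∑ m ∈ Finset.range (ℓ + 1), k m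

/-- The initial conditions `[0, …, 0, 1, 0, …, 0]` with the `1` in position `i`. -/
def unitInitial (i : ℕ) : ℕ → ℕ := fun m => if m = i then 1 else 0

/-- The array that belongs to `i`: first and last rows even for `i` even, odd for `i` odd. -/
def firstPart (i : ℕ) : ℕ := if Even i then 2 else 1

/-- The admissible colored partitions of `n` with exactly `j` parts for `k_i = 1` and all other
initial conditions `0`. -/
def admissibleSet (ℓ i j n : ℕ) : Set (Multiset (ℕ × ℕ)) :=
  {π | IsAdmissible (firstPart i) ℓ (unitInitial i) π ∧
    Multiset.card π = j ∧ (π.map Prod.snd).sum = n}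

theorem admissibleSet_finite (ℓ i j n : ℕ) : (admissibleSet ℓ i j n).Finite := by
  classical
  refine Set.Finite.subset (Finset.finite_toSet
    (Multiset.powerset (j • (Finset.range (2 * ℓ) ×ˢ Finset.range (n + 1)).val)).toFinset) ?_
  rintro π ⟨⟨hπ, -⟩, hj, hn⟩
  simp only [Finset.mem_coe, Multiset.mem_toFinset, Multiset.mem_powerset]
  rw [Multiset.le_iff_count]
  intro p
  by_cases hp : p ∈ π
  · have h1 : p ∈ (Finset.range (2 * ℓ) ×ˢ Finset.range (n + 1)).val := by
      have h := hπ p hp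
      have h2 : p.2 ≤ n := hn ▸ Multiset.le_sum_of_mem (Multiset.mem_map_of_mem _ hp)
      obtain ⟨-, hr1, hr2, -⟩ := h
      simp only [Finset.mem_val, Finset.mem_product, Finset.mem_range]
      omega
    rw [Multiset.count_nsmul]
    calc π.count p ≤ j := hj ▸ Multiset.count_le_card p π
      _ ≤ _ := Nat.le_mul_of_pos_right _ (Multiset.count_pos.2 h1)
  · rw [Multiset.count_eq_zero_of_notMem hp]
    exact Nat.zero_le _

/-- `F⋆(i, j, n)`. -/
noncomputable def Fstar (ℓ i j n : ℕ) : ℕ := (admissibleSet ℓ i j n).ncard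

/-- `P⋆_i(z, q) = ∑ F⋆(i, j, n) z ^ j q ^ n`, in the ring of formal power series in `z` over the
ring of formal power series in `q` with integer coefficients. -/
noncomputable def Pstar (ℓ i : ℕ) : ℤ⟦X⟧⟦X⟧ :=
  PowerSeries.mk fun j => PowerSeries.mk fun n => (Fstar ℓ i j n : ℤ)

/-! ### The multisum -/

/-- `(a; b)_n = ∏_{j = 1}^n (1 - a b ^ (j - 1))`. -/
noncomputable def qPoch (a b : ℤ⟦X⟧) (n : ℕ) : ℤ⟦X⟧ := ∏ j ∈ Finset.range n, (1 - a * b ^ j)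

/-- `N_a = n_a + n_{a+1} + ⋯ + n_ℓ`; the index `a : Fin ℓ` stands for the index `a + 1` of
`n_1, …, n_ℓ`. -/
def tailSum {ℓ : ℕ} (n : Fin ℓ → ℕ) (a : Fin ℓ) : ℕ := ∑ b ∈ Finset.Ici a, n b

/-- The exponent `N_1 ^ 2 + ⋯ + N_ℓ ^ 2 + N_{i+1} + ⋯ + N_ℓ`. -/
def qExponent {ℓ : ℕ} (i : ℕ) (n : Fin ℓ → ℕ) : ℕ :=
  ∑ a, tailSum n a ^ 2 + ∑ a with i ≤ a.val, tailSum n a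

/-- The denominator `(q; q)_{n_1} ⋯ (q; q)_{n_{ℓ-1}} (q²; q²)_{n_ℓ}`. -/
noncomputable def denominator {ℓ : ℕ} (n : Fin ℓ → ℕ) : ℤ⟦X⟧ :=
  ∏ a : Fin ℓ, if a.val + 1 = ℓ then qPoch (PowerSeries.X ^ 2) (PowerSeries.X ^ 2) (n a)
    else qPoch PowerSeries.X PowerSeries.X (n a)

theorem constantCoeff_denominator {ℓ : ℕ} (n : Fin ℓ → ℕ) :
    PowerSeries.constantCoeff (denominator n) = 1 := by
  unfold denominator qPoch
  rw [map_prod]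
  refine Finset.prod_eq_one fun a _ => ?_
  split_ifs <;> simp

/-- `invOfUnit _ 1` is the inverse of a power series with constant term `1`. -/
theorem denominator_mul_inv {ℓ : ℕ} (n : Fin ℓ → ℕ) :
    denominator n * PowerSeries.invOfUnit (denominator n) 1 = 1 :=
  PowerSeries.mul_invOfUnit _ _ (by simpa using constantCoeff_denominator n)

/-- The summand `z ^ (n_1 + ⋯ + n_ℓ) q ^ (N_1² + ⋯ + N_ℓ² + N_{i+1} + ⋯ + N_ℓ)` divided by
`(q; q)_{n_1} ⋯ (q; q)_{n_{ℓ-1}} (q²; q²)_{n_ℓ}`. -/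
noncomputable def summand (ℓ i : ℕ) (n : Fin ℓ → ℕ) : ℤ⟦X⟧⟦X⟧ :=
  PowerSeries.X ^ (∑ a, n a) *
    PowerSeries.C (PowerSeries.X ^ qExponent i n * PowerSeries.invOfUnit (denominator n) 1)

end CMPP

/-!
Both sides satisfy the same system of functional equations, and that system has one solution.
Write `s i N` for the coefficient of `z ^ N` in the series with index `i`. The equations are
`s i 0 = 1`, `s 0 N = q ^ N * s 1 N`, and for `1 ≤ i ≤ ℓ` and `N ≥ 1`
`(1 + q ^ (2 N)) s i N = q ^ N (s (i - 1) N + s (i + 1) N) + q ^ (2 N - 1) s i (N - 1)`,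
where `s (ℓ + 1)` stands for `s (ℓ - 1)`. By induction on `N` the last term is the
same for two solutions, and every other term on the right of the second and third equations carries
a factor `q ^ N`, so the difference of two solutions is divisible by all powers of `q` and vanishes
(`SatisfiesRecurrence.unique`).

For the multisum the equations follow by induction on `ℓ`. Summing over `n_1` last gives
`s_{ℓ+1} (i + 1) N = q ^ (N ^ 2) ∑_{a + M = N} s_ℓ i M / (q; q)_a`, and this operator preserves the
equations: after substitution the term of `s_ℓ i M` has the coefficient
`(1 - q ^ a) (1 - q ^ (a + 2 M)) / (q; q)_a`, in which `1 - q ^ a` cancels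
(`addVariable_recurrence`). The case `ℓ = 1` is checked directly.

For the admissible colored partitions, total level one means that no two occupied positions, the
initial one included, lie on a common downward path. So the parts are distinct lattice points
(row, column), any two of them at column distance at least their row distance plus two, all in the
forward cone of `(i, -1)` (`isAdmissible_iff`; for `i = 0` the cone of `(0, -1)` has the same points
in the array as that of the initial position `(1, 0)`). The cone of `(r, c)` consists of the point
`(r, c + 2)` and the union of the cones of `(r - 1, c + 1)` and `(r + 1, c + 1)`, which intersect in
the cone of `(r, c + 2)`. Since these are forward cones, a chain avoiding `(r, c + 2)` lies in one
of the two. Inclusion and exclusion (`ncard_chains_succ`), together with invariance under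
translation of the columns, give the recurrence for all rows `1 ≤ r ≤ 2 ℓ - 1`, and the reflection
of the array in its middle row gives the equation at `i = ℓ`.
-/

namespace CMPP

open PowerSeries Finset

/-! ### The recurrence -/

/-- The system of functional equations shared by both sides. Here `s i N` is the coefficient of
`z ^ N` in the series with index `i`. The equation at `i = ℓ` is that at an interior index with
`s (ℓ + 1)` replaced by its mirror image `s (ℓ - 1)`. -/
structure SatisfiesRecurrence (ℓ : ℕ) (s : ℕ → ℕ → ℤ⟦X⟧) : Prop where
  init : ∀ i ≤ ℓ, s i 0 = 1
  bottom : ∀ N, s 0 N = X ^ N * s 1 N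
  step : ∀ i, i + 1 < ℓ → ∀ N, (1 + X ^ (2 * N + 2)) * s (i + 1) (N + 1) =
    X ^ (N + 1) * (s i (N + 1) + s (i + 2) (N + 1)) + X ^ (2 * N + 1) * s (i + 1) N
  top : ∀ i, i + 1 = ℓ → ∀ N, (1 + X ^ (2 * N + 2)) * s (i + 1) (N + 1) =
    X ^ (N + 1) * (2 * s i (N + 1)) + X ^ (2 * N + 1) * s (i + 1) N

theorem isUnit_one_add_X_pow (m : ℕ) : IsUnit (1 + X ^ (m + 1) : ℤ⟦X⟧) := by
  rw [PowerSeries.isUnit_iff_constantCoeff]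
  simp

/-- The difference of two solutions is, for each `N`, divisible by every power of `X`: each
application of the equations gains a factor `X ^ (N + 1)`. -/
theorem SatisfiesRecurrence.unique {ℓ : ℕ} (hℓ : 1 ≤ ℓ) {s t : ℕ → ℕ → ℤ⟦X⟧}
    (hs : SatisfiesRecurrence ℓ s) (ht : SatisfiesRecurrence ℓ t) (N : ℕ) :
    ∀ i ≤ ℓ, s i N = t i N := by
  induction N with
  | zero => intro i hi; rw [hs.init i hi, ht.init i hi]
  | succ N ih =>
    have key : ∀ m : ℕ, ∀ i ≤ ℓ, (X : ℤ⟦X⟧) ^ m ∣ s i (N + 1) - t i (N + 1) := by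
      intro m
      induction m with
      | zero => intro i _; simp
      | succ m ihm =>
        have hX : (X : ℤ⟦X⟧) ^ (m + 1) ∣ X ^ (N + 1) * X ^ m := by
          rw [← pow_add]; exact pow_dvd_pow _ (by omega)
        have gain : ∀ f : ℤ⟦X⟧, X ^ m ∣ f → X ^ (m + 1) ∣ X ^ (N + 1) * f := fun f hf =>
          hX.trans (mul_dvd_mul_left _ hf)
        rintro (_ | i) hi
        · rw [hs.bottom, ht.bottom, ← mul_sub]
          exact gain _ (ihm 1 hℓ)
        · have hN := ih (i + 1) hi
          rw [← (isUnit_one_add_X_pow (2 * N + 1)).dvd_mul_left, mul_sub]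
          rcases lt_or_eq_of_le hi with h | h
          · rw [hs.step i h, ht.step i h, hN]
            have := gain _ (dvd_add (ihm i (by omega)) (ihm (i + 2) h))
            convert this using 1
            ring
          · rw [hs.top i h, ht.top i h, hN]
            have := gain _ ((ihm i (by omega)).mul_left 2)
            convert this using 1
            ring
    intro i hi
    rw [← sub_eq_zero]
    ext m
    exact (X_pow_dvd_iff.1 (key (m + 1) i hi)) m (Nat.lt_succ_self m)

/-! ### The multisum -/

theorem constantCoeff_qPoch_X_pow (k n : ℕ) :
    constantCoeff (qPoch (X ^ (k + 1)) (X ^ (k + 1)) n) = 1 := by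
  simp [qPoch]

/-- `1 / (q; q)_n`. -/
noncomputable def invPoch (n : ℕ) : ℤ⟦X⟧ := invOfUnit (qPoch X X n) 1

theorem eq_invOfUnit_of_mul_eq_one {f g : ℤ⟦X⟧} (hf : constantCoeff f = 1) (h : f * g = 1) :
    g = invOfUnit f 1 := by
  have h' : f * invOfUnit f 1 = 1 := mul_invOfUnit _ _ (by simpa using hf)
  calc g = g * (f * invOfUnit f 1) := by rw [h', mul_one]
    _ = (f * g) * invOfUnit f 1 := by ring
    _ = _ := by rw [h, one_mul]

theorem qPoch_mul_invPoch (n : ℕ) : qPoch X X n * invPoch n = 1 :=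
  mul_invOfUnit _ _ (by simpa using constantCoeff_qPoch_X_pow 0 n)

theorem one_sub_mul_invPoch_succ (n : ℕ) :
    (1 - X ^ (n + 1)) * invPoch (n + 1) = invPoch n := by
  refine eq_invOfUnit_of_mul_eq_one (by simpa using constantCoeff_qPoch_X_pow 0 n) ?_
  conv_rhs => rw [← qPoch_mul_invPoch (n + 1)]
  simp only [qPoch, prod_range_succ]
  ring

/-- The operator that adds one summation variable at the front of the multisum. -/
noncomputable def addVariable (t : ℕ → ℤ⟦X⟧) (N : ℕ) : ℤ⟦X⟧ :=
  X ^ (N ^ 2) * ∑ p ∈ antidiagonal N, invPoch p.1 * t p.2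

theorem addVariable_add (t u : ℕ → ℤ⟦X⟧) (N : ℕ) :
    addVariable (fun M => t M + u M) N = addVariable t N + addVariable u N := by
  simp only [addVariable, mul_add, sum_add_distrib]

/-- `addVariable` preserves the recurrence in its interior form: if `u` plays the part of
`s (i - 1) + s (i + 1)` for `t = s i`, the same holds after the operator is applied. The term
with `p = (a, M)` carries the factor `(1 - q ^ a) (1 - q ^ (a + 2 M))`, and `1 - q ^ a` cancels
against `1 / (q; q)_a`. -/
theorem addVariable_recurrence {t u : ℕ → ℤ⟦X⟧} (h0 : u 0 = 2 * t 0)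
    (h : ∀ N, (1 + X ^ (2 * N + 2)) * t (N + 1) =
      X ^ (N + 1) * u (N + 1) + X ^ (2 * N + 1) * t N) (N : ℕ) :
    (1 + X ^ (2 * N + 2)) * addVariable t (N + 1) =
      X ^ (N + 1) * addVariable u (N + 1) + X ^ (2 * N + 1) * addVariable t N := by
  -- The hypothesis on `u` and `t`, summed; its last term is reindexed from `M` to `M - 1`.
  have hu : ∑ p ∈ antidiagonal (N + 1), X ^ p.1 * (invPoch p.1 * (X ^ p.2 * u p.2)) =
      ∑ p ∈ antidiagonal (N + 1), X ^ p.1 * (invPoch p.1 * ((1 + X ^ (2 * p.2)) * t p.2)) -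
      ∑ p ∈ antidiagonal N, X ^ (N + 1 + p.2) * (invPoch p.1 * t p.2) := by
    rw [Finset.Nat.sum_antidiagonal_succ', Finset.Nat.sum_antidiagonal_succ']
    have hrw : ∀ M, X ^ (M + 1) * u (M + 1) = (1 + X ^ (2 * (M + 1))) * t (M + 1) -
        X ^ (2 * M + 1) * t M := by
      intro M
      rw [show 2 * (M + 1) = 2 * M + 2 by ring, h M]
      ring
    simp only [hrw, h0]
    have : ∀ p ∈ antidiagonal N, X ^ (N + 1 + p.2) * (invPoch p.1 * t p.2) =
        X ^ p.1 * (invPoch p.1 * (X ^ (2 * p.2 + 1) * t p.2)) := by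
      intro p hp
      rw [← mem_antidiagonal.1 hp]
      ring
    rw [sum_congr rfl this]
    simp only [mul_sub, sum_sub_distrib]
    ring
  have hu' : X ^ (N + 1) * ∑ p ∈ antidiagonal (N + 1), invPoch p.1 * u p.2 =
      ∑ p ∈ antidiagonal (N + 1), X ^ p.1 * (invPoch p.1 * (X ^ p.2 * u p.2)) := by
    rw [mul_sum]
    refine sum_congr rfl fun p hp => ?_
    rw [← mem_antidiagonal.1 hp]
    ring
  -- For `a + M = N + 1` the coefficients combine to `(1 - q ^ a) (1 - q ^ (a + 2 M))`.
  have ht : (1 + X ^ (2 * N + 2)) * ∑ p ∈ antidiagonal (N + 1), invPoch p.1 * t p.2 -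
      ∑ p ∈ antidiagonal (N + 1), X ^ p.1 * (invPoch p.1 * ((1 + X ^ (2 * p.2)) * t p.2)) =
      ∑ p ∈ antidiagonal N, (1 - X ^ (N + 1 + p.2)) * (invPoch p.1 * t p.2) := by
    rw [mul_sum, ← sum_sub_distrib]
    have : ∀ p ∈ antidiagonal (N + 1), (1 + X ^ (2 * N + 2)) * (invPoch p.1 * t p.2) -
        X ^ p.1 * (invPoch p.1 * ((1 + X ^ (2 * p.2)) * t p.2)) =
        (1 - X ^ (N + 1 + p.2)) * ((1 - X ^ p.1) * invPoch p.1 * t p.2) := by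
      intro p hp
      rw [show 2 * N + 2 = 2 * (N + 1) by ring, ← mem_antidiagonal.1 hp]
      ring
    rw [sum_congr rfl this, Finset.Nat.sum_antidiagonal_succ]
    simp only [one_sub_mul_invPoch_succ]
    simp
  have hfin : ∑ p ∈ antidiagonal N, (1 - X ^ (N + 1 + p.2)) * (invPoch p.1 * t p.2) =
      ∑ p ∈ antidiagonal N, invPoch p.1 * t p.2 -
      ∑ p ∈ antidiagonal N, X ^ (N + 1 + p.2) * (invPoch p.1 * t p.2) := by
    simp only [sub_mul, one_mul, sum_sub_distrib]
  rw [hfin] at ht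
  unfold addVariable
  linear_combination (X ^ ((N + 1) ^ 2) : ℤ⟦X⟧) * (ht - hu - hu')

/-- The analogue of `addVariable_recurrence` at `i = 1`, where `s 0` is not in the image of
`addVariable` but is given by the bottom equation. -/
theorem addVariable_recurrence_bottom {t u : ℕ → ℤ⟦X⟧} (h : ∀ N, t N = X ^ N * u N) (N : ℕ) :
    (1 + X ^ (2 * N + 2)) * addVariable t (N + 1) =
      X ^ (N + 1) * (X ^ (N + 1) * addVariable t (N + 1) + addVariable u (N + 1)) +
        X ^ (2 * N + 1) * addVariable t N := by
  have key : ∑ p ∈ antidiagonal (N + 1), invPoch p.1 * t p.2 -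
      X ^ (N + 1) * ∑ p ∈ antidiagonal (N + 1), invPoch p.1 * u p.2 =
      ∑ p ∈ antidiagonal N, invPoch p.1 * t p.2 := by
    rw [mul_sum, ← sum_sub_distrib]
    have : ∀ p ∈ antidiagonal (N + 1), invPoch p.1 * t p.2 - X ^ (N + 1) * (invPoch p.1 * u p.2) =
        (1 - X ^ p.1) * invPoch p.1 * t p.2 := by
      intro p hp
      rw [h, ← mem_antidiagonal.1 hp]
      ring
    rw [sum_congr rfl this, Finset.Nat.sum_antidiagonal_succ]
    simp only [one_sub_mul_invPoch_succ]
    simp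
  unfold addVariable
  linear_combination (X ^ ((N + 1) ^ 2) : ℤ⟦X⟧) * key

/-- The coefficient of `z ^ N` in the multisum. -/
noncomputable def multisum (ℓ i N : ℕ) : ℤ⟦X⟧ :=
  ∑ n ∈ Finset.Nat.antidiagonalTuple ℓ N, X ^ qExponent i n * invOfUnit (denominator n) 1

theorem tailSum_zero {ℓ : ℕ} (n : Fin (ℓ + 1) → ℕ) : tailSum n 0 = ∑ a, n a := by
  unfold tailSum
  congr 1
  ext a
  simp

theorem tailSum_cons_succ {ℓ : ℕ} (m : ℕ) (n : Fin ℓ → ℕ) (a : Fin ℓ) :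
    tailSum (Fin.cons m n : Fin (ℓ + 1) → ℕ) a.succ = tailSum n a := by
  unfold tailSum
  rw [← Fin.map_succEmb_Ici, sum_map]
  simp

theorem qExponent_cons_succ {ℓ : ℕ} (i m : ℕ) (n : Fin ℓ → ℕ) :
    qExponent (i + 1) (Fin.cons m n : Fin (ℓ + 1) → ℕ) = (m + ∑ a, n a) ^ 2 + qExponent i n := by
  unfold qExponent
  simp only [sum_filter, Fin.sum_univ_succ, tailSum_cons_succ, tailSum_zero, Fin.cons_zero,
    Fin.cons_succ]
  simp [add_assoc]

theorem qExponent_zero {ℓ : ℕ} (n : Fin (ℓ + 1) → ℕ) :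
    qExponent 0 n = ∑ a, n a + qExponent 1 n := by
  unfold qExponent
  simp only [sum_filter]
  rw [Fin.sum_univ_succ (fun a : Fin (ℓ + 1) => if 0 ≤ a.val then tailSum n a else 0),
    Fin.sum_univ_succ (fun a : Fin (ℓ + 1) => if 1 ≤ a.val then tailSum n a else 0), tailSum_zero]
  simp
  omega

theorem denominator_cons {ℓ : ℕ} (m : ℕ) (n : Fin (ℓ + 1) → ℕ) :
    denominator (Fin.cons m n : Fin (ℓ + 2) → ℕ) = qPoch X X m * denominator n := by
  unfold denominator
  rw [Fin.prod_univ_succ]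
  simp

theorem invOfUnit_denominator_cons {ℓ : ℕ} (m : ℕ) (n : Fin (ℓ + 1) → ℕ) :
    invOfUnit (denominator (Fin.cons m n : Fin (ℓ + 2) → ℕ)) 1 =
      invPoch m * invOfUnit (denominator n) 1 := by
  symm
  apply eq_invOfUnit_of_mul_eq_one (constantCoeff_denominator _)
  rw [denominator_cons]
  calc _ = (qPoch X X m * invPoch m) * (denominator n * invOfUnit (denominator n) 1) := by ring
    _ = 1 := by rw [qPoch_mul_invPoch, denominator_mul_inv, one_mul]

theorem sum_antidiagonalTuple_succ {M : Type*} [AddCommMonoid M] (k N : ℕ)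
    (f : (Fin (k + 1) → ℕ) → M) :
    ∑ n ∈ Finset.Nat.antidiagonalTuple (k + 1) N, f n =
      ∑ p ∈ antidiagonal N, ∑ n ∈ Finset.Nat.antidiagonalTuple k p.2, f (Fin.cons p.1 n) := by
  rw [sum_sigma']
  symm
  refine sum_bij (fun x _ => (Fin.cons x.1.1 x.2 : Fin (k + 1) → ℕ)) ?_ ?_ ?_ ?_
  · rintro ⟨p, n⟩ h
    simp only [mem_sigma, HasAntidiagonal.mem_antidiagonal, Finset.Nat.mem_antidiagonalTuple] at h ⊢
    rw [Fin.sum_cons, h.2, h.1]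
  · rintro ⟨⟨a, b⟩, n⟩ h ⟨⟨a', b'⟩, n'⟩ h' he
    simp only [mem_sigma, HasAntidiagonal.mem_antidiagonal,
      Finset.Nat.mem_antidiagonalTuple] at h h'
    obtain ⟨rfl, rfl⟩ := Fin.cons_injective2 he
    obtain rfl : b = b' := h.2.symm.trans h'.2
    rfl
  · intro n hn
    rw [Finset.Nat.mem_antidiagonalTuple, Fin.sum_univ_succ] at hn
    refine ⟨⟨(n 0, ∑ a, n (Fin.succ a)), Fin.tail n⟩, ?_, Fin.cons_self_tail n⟩
    simp only [mem_sigma, HasAntidiagonal.mem_antidiagonal, Finset.Nat.mem_antidiagonalTuple]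
    exact ⟨hn, rfl⟩
  · intros; rfl

theorem multisum_succ_succ (ℓ i N : ℕ) :
    multisum (ℓ + 2) (i + 1) N = addVariable (multisum (ℓ + 1) i) N := by
  unfold multisum addVariable
  rw [sum_antidiagonalTuple_succ, mul_sum]
  refine sum_congr rfl fun p hp => ?_
  rw [mul_sum, mul_sum]
  refine sum_congr rfl fun n hn => ?_
  rw [qExponent_cons_succ, Finset.Nat.mem_antidiagonalTuple.1 hn, mem_antidiagonal.1 hp,
    invOfUnit_denominator_cons]
  ring

theorem multisum_zero_index (ℓ N : ℕ) :
    multisum (ℓ + 1) 0 N = X ^ N * multisum (ℓ + 1) 1 N := by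
  unfold multisum
  rw [mul_sum]
  refine sum_congr rfl fun n hn => ?_
  rw [qExponent_zero, Finset.Nat.mem_antidiagonalTuple.1 hn]
  ring

theorem multisum_at_zero (ℓ i : ℕ) : multisum ℓ i 0 = 1 := by
  have h : invOfUnit (denominator (0 : Fin ℓ → ℕ)) 1 = 1 := by
    refine (eq_invOfUnit_of_mul_eq_one (constantCoeff_denominator _) ?_).symm
    simp [denominator, qPoch]
  have h' : qExponent i (0 : Fin ℓ → ℕ) = 0 := by simp [qExponent, tailSum]
  rw [multisum, Finset.Nat.antidiagonalTuple_zero_right, sum_singleton, h, h', pow_zero, one_mul]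

theorem multisum_one_one (N : ℕ) :
    multisum 1 1 N = X ^ (N ^ 2) * invOfUnit (qPoch (X ^ 2) (X ^ 2) N) 1 := by
  simp [multisum, qExponent, tailSum, denominator]

theorem one_sub_mul_multisum_one_one (N : ℕ) :
    (1 - X ^ (2 * N + 2)) * multisum 1 1 (N + 1) = X ^ (2 * N + 1) * multisum 1 1 N := by
  have h : (1 - X ^ (2 * N + 2)) * invOfUnit (qPoch (X ^ 2) (X ^ 2) (N + 1)) 1 =
      invOfUnit (qPoch (X ^ 2) (X ^ 2) N) (1 : ℤˣ) := by
    refine eq_invOfUnit_of_mul_eq_one (constantCoeff_qPoch_X_pow 1 N) ?_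
    have h' : qPoch (X ^ 2) (X ^ 2) (N + 1) * invOfUnit (qPoch (X ^ 2) (X ^ 2) (N + 1)) 1 = 1 :=
      mul_invOfUnit _ _ (by simpa using constantCoeff_qPoch_X_pow 1 (N + 1))
    conv_rhs => rw [← h']
    have : qPoch (X ^ 2) (X ^ 2) (N + 1) = qPoch (X ^ 2) (X ^ 2) N * (1 - X ^ (2 * N + 2)) := by
      simp only [qPoch, prod_range_succ]
      ring
    rw [this]
    ring
  rw [multisum_one_one, multisum_one_one, ← h]
  ring

/-- Only the equation at `i + 1 = 1` needs the separate lemma: there the neighbour `s 0` is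
`X ^ N * s 1 N`. -/
theorem multisum_satisfiesRecurrence (ℓ : ℕ) :
    SatisfiesRecurrence (ℓ + 1) (multisum (ℓ + 1)) := by
  induction ℓ with
  | zero =>
    refine ⟨fun i _ => multisum_at_zero _ i, multisum_zero_index 0, fun i h => by omega, ?_⟩
    intro i hi N
    obtain rfl : i = 0 := by omega
    rw [multisum_zero_index]
    linear_combination one_sub_mul_multisum_one_one N
  | succ ℓ ih =>
    refine ⟨fun i _ => multisum_at_zero _ i, multisum_zero_index _, ?_, ?_⟩
    · rintro (_ | i) hi N
      · rw [multisum_zero_index]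
        simp only [multisum_succ_succ]
        exact addVariable_recurrence_bottom ih.bottom N
      · simp only [multisum_succ_succ]
        rw [← addVariable_add (multisum (ℓ + 1) i) (multisum (ℓ + 1) (i + 2))]
        exact addVariable_recurrence (t := multisum (ℓ + 1) (i + 1))
          (u := fun M => multisum (ℓ + 1) i M + multisum (ℓ + 1) (i + 2) M)
          (by simp only [multisum_at_zero]; norm_num) (ih.step i (by omega)) N
    · rintro (_ | i) hi N
      · omega
      · simp only [multisum_succ_succ]
        rw [two_mul (addVariable _ _), ← addVariable_add]
        exact addVariable_recurrence (t := multisum (ℓ + 1) (i + 1))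
          (u := fun M => multisum (ℓ + 1) i M + multisum (ℓ + 1) i M)
          (by simp only [multisum_at_zero]; norm_num)
          (fun M => by rw [← two_mul]; exact ih.top i (by omega) M) N

theorem hasSum_summand (ℓ i : ℕ) :
    HasSum (fun n : Fin ℓ → ℕ => summand ℓ i n) (PowerSeries.mk (multisum ℓ i)) := by
  rw [PowerSeries.WithPiTopology.hasSum_iff_hasSum_coeff]
  intro N
  have hc : ∀ n : Fin ℓ → ℕ, coeff N (summand ℓ i n) =
      if ∑ a, n a = N then X ^ qExponent i n * invOfUnit (denominator n) 1 else 0 := by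
    intro n
    rw [summand, mul_comm, coeff_C_mul, coeff_X_pow]
    simp [eq_comm]
  rw [coeff_mk, multisum]
  have : ∀ n ∈ Finset.Nat.antidiagonalTuple ℓ N, coeff N (summand ℓ i n) =
      X ^ qExponent i n * invOfUnit (denominator n) 1 := by
    intro n hn
    rw [hc, if_pos (Finset.Nat.mem_antidiagonalTuple.1 hn)]
  rw [← sum_congr rfl this]
  refine hasSum_sum_of_ne_finset_zero fun n hn => ?_
  rw [hc, if_neg (fun h => hn (Finset.Nat.mem_antidiagonalTuple.2 h))]

/-! ### Chains of lattice points -/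

/-- The point `q` lies strictly to the right of `p`, and no downward path meets both. Points are
written as (row, column). -/
def Precedes (p q : ℤ × ℤ) : Prop :=
  p.2 + (q.1 - p.1) + 2 ≤ q.2 ∧ p.2 + (p.1 - q.1) + 2 ≤ q.2

/-- The points in rows `1, …, R` that are preceded by `p` and lie on the sublattice of `p`. The
apex `p` itself may lie in the rows `0` and `R + 1`. -/
def cone (R : ℤ) (p : ℤ × ℤ) : Set (ℤ × ℤ) :=
  {q | 1 ≤ q.1 ∧ q.1 ≤ R ∧ Precedes p q ∧ Even (p.1 + p.2 + q.1 + q.2)}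

/-- The chains of `j` points in the cone of `p`, with sum of columns `n`. -/
def chains (R : ℤ) (p : ℤ × ℤ) (j : ℕ) (n : ℤ) : Set (Finset (ℤ × ℤ)) :=
  {S | (∀ q ∈ S, q ∈ cone R p) ∧ (∀ a ∈ S, ∀ b ∈ S, a ≠ b → Precedes a b ∨ Precedes b a) ∧
    S.card = j ∧ ∑ q ∈ S, q.2 = n}

theorem column_le_of_mem_cone {R : ℤ} {p q : ℤ × ℤ} (h : q ∈ cone R p) : p.2 + 2 ≤ q.2 := by
  obtain ⟨-, -, ⟨h1, h2⟩, -⟩ := h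
  omega

theorem chains_finite (R : ℤ) (p : ℤ × ℤ) (j : ℕ) (n : ℤ) : (chains R p j n).Finite := by
  refine Set.Finite.subset (Finset.finite_toSet
    (Finset.Icc (1 : ℤ) R ×ˢ Finset.Icc (p.2 + 2) (n - j * (p.2 + 2) + (p.2 + 2))).powerset) ?_
  rintro S ⟨hS, -, hj, hn⟩
  rw [Finset.mem_coe, Finset.mem_powerset]
  intro q hq
  have h1 : ∑ q ∈ S, (q.2 - (p.2 + 2)) = n - j * (p.2 + 2) := by
    rw [sum_sub_distrib, hn, sum_const, hj, nsmul_eq_mul]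
  have h2 : q.2 - (p.2 + 2) ≤ ∑ q ∈ S, (q.2 - (p.2 + 2)) :=
    single_le_sum (f := fun q : ℤ × ℤ => q.2 - (p.2 + 2))
      (fun x hx => sub_nonneg.2 (column_le_of_mem_cone (hS x hx))) hq
  have h3 := column_le_of_mem_cone (hS q hq)
  have h4 := hS q hq
  rw [Finset.mem_product, Finset.mem_Icc, Finset.mem_Icc]
  exact ⟨⟨h4.1, h4.2.1⟩, h3, by linarith⟩

theorem chains_congr {R : ℤ} {p p' : ℤ × ℤ} (h : cone R p = cone R p') (j : ℕ) (n : ℤ) :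
    chains R p j n = chains R p' j n := by
  simp only [chains, h]

theorem chains_eq_empty_of_neg {R r : ℤ} {j : ℕ} {n : ℤ} (hn : n < 0) :
    chains R (r, -1) j n = ∅ := by
  rw [Set.eq_empty_iff_forall_notMem]
  rintro S ⟨hS, -, -, h⟩
  have : 0 ≤ ∑ q ∈ S, q.2 := sum_nonneg fun q hq => by
    have := column_le_of_mem_cone (hS q hq)
    simp only at this
    omega
  omega

/-- The points of a cone other than the point next to its apex form the union of two cones. As a
chain lies in a cone as soon as its leftmost point does, each chain that avoids that point lies in
one of the two cones. -/
theorem chains_succ_eq {R r : ℤ} (h1 : 1 ≤ r) (hR : r ≤ R) (c : ℤ) (j : ℕ) (n : ℤ) :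
    chains R (r, c) (j + 1) n =
      (chains R (r - 1, c + 1) (j + 1) n ∪ chains R (r + 1, c + 1) (j + 1) n) ∪
        (fun S => insert (r, c + 2) S) '' chains R (r, c + 2) j (n - (c + 2)) := by
  ext S
  constructor
  · rintro ⟨hS, hc, hj, hn⟩
    by_cases ha : (r, c + 2) ∈ S
    · right
      refine ⟨S.erase (r, c + 2), ⟨?_, ?_, ?_, ?_⟩, insert_erase ha⟩
      · intro q hq
        obtain ⟨hne, hq⟩ := mem_erase.1 hq
        obtain ⟨g1, g2, ⟨g3, g4⟩, g5⟩ := hS q hq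
        rcases hc _ ha q hq hne.symm with h | ⟨h, h'⟩
        · refine ⟨g1, g2, h, ?_⟩
          simp only [Int.even_iff] at g5 ⊢
          omega
        · simp only at *
          omega
      · intro a ha b hb
        exact hc a (mem_of_mem_erase ha) b (mem_of_mem_erase hb)
      · rw [card_erase_of_mem ha, hj, Nat.add_sub_cancel]
      · rw [← hn, ← add_sum_erase S _ ha]
        ring
    · left
      have hcov : ∀ q ∈ S, q ∈ cone R (r - 1, c + 1) ∨ q ∈ cone R (r + 1, c + 1) := by
        rintro ⟨a, b⟩ hq
        obtain ⟨g1, g2, ⟨g3, g4⟩, g5⟩ := hS _ hq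
        have hne : ¬ (a = r ∧ b = c + 2) := by
          rintro ⟨rfl, rfl⟩
          exact ha hq
        simp only [cone, Precedes, Set.mem_ofPred_eq, Int.even_iff] at *
        omega
      by_cases hA : ∀ q ∈ S, q ∈ cone R (r - 1, c + 1)
      · exact Or.inl ⟨hA, hc, hj, hn⟩
      · -- A point outside one cone and a point outside the other are never comparable.
        right
        push Not at hA
        obtain ⟨p, hp, hpA⟩ := hA
        refine ⟨fun q hq => ?_, hc, hj, hn⟩
        by_contra hqB
        have hqA := (hcov q hq).resolve_right hqB
        have hpB := (hcov p hp).resolve_left hpA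
        have hne : p ≠ q := by
          rintro rfl
          exact hpA hqA
        have hpq := hc p hp q hq hne
        simp only [cone, Precedes, Set.mem_ofPred_eq, Int.even_iff] at *
        omega
  · have mono : ∀ p : ℤ × ℤ, (∀ q ∈ cone R p, q ∈ cone R (r, c)) →
        ∀ S ∈ chains R p (j + 1) n, S ∈ chains R (r, c) (j + 1) n :=
      fun p hp S hS => ⟨fun q hq => hp q (hS.1 q hq), hS.2⟩
    rintro ((hS | hS) | ⟨T, ⟨hT, hc, hj, hn⟩, rfl⟩)
    · refine mono _ (fun q hq => ?_) S hS
      simp only [cone, Precedes, Set.mem_ofPred_eq, Int.even_iff] at *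
      omega
    · refine mono _ (fun q hq => ?_) S hS
      simp only [cone, Precedes, Set.mem_ofPred_eq, Int.even_iff] at *
      omega
    · have ha : (r, c + 2) ∉ T := fun h => by
        have := column_le_of_mem_cone (hT _ h)
        simp at this
      refine ⟨?_, ?_, ?_, ?_⟩
      · intro q hq
        rcases mem_insert.1 hq with rfl | hq
        · simp only [cone, Precedes, Set.mem_ofPred_eq, Int.even_iff]
          omega
        · have := hT q hq
          simp only [cone, Precedes, Set.mem_ofPred_eq, Int.even_iff] at *
          omega
      · intro a ha b hb hab
        rcases mem_insert.1 ha with rfl | ha <;> rcases mem_insert.1 hb with rfl | hb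
        · exact absurd rfl hab
        · exact Or.inl (hT b hb).2.2.1
        · exact Or.inr (hT a ha).2.2.1
        · exact hc a ha b hb hab
      · rw [card_insert_of_notMem ha, hj]
      · rw [sum_insert ha, hn]
        ring

theorem chains_inter_chains (R r c : ℤ) (j : ℕ) (n : ℤ) :
    chains R (r - 1, c + 1) j n ∩ chains R (r + 1, c + 1) j n = chains R (r, c + 2) j n := by
  ext S
  have : ∀ q : ℤ × ℤ, q ∈ cone R (r - 1, c + 1) ∧ q ∈ cone R (r + 1, c + 1) ↔
      q ∈ cone R (r, c + 2) := by
    intro q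
    simp only [cone, Precedes, Set.mem_ofPred_eq, Int.even_iff]
    omega
  simp only [chains, Set.mem_inter_iff, Set.mem_ofPred_eq, ← this]
  constructor
  · rintro ⟨h, h'⟩
    exact ⟨fun q hq => ⟨h.1 q hq, h'.1 q hq⟩, h.2⟩
  · rintro ⟨h, h'⟩
    exact ⟨⟨fun q hq => (h q hq).1, h'⟩, ⟨fun q hq => (h q hq).2, h'⟩⟩

/-- Inclusion and exclusion for `chains_succ_eq`. -/
theorem ncard_chains_succ {R r : ℤ} (h1 : 1 ≤ r) (hR : r ≤ R) (c : ℤ) (j : ℕ) (n : ℤ) :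
    (chains R (r, c) (j + 1) n).ncard + (chains R (r, c + 2) (j + 1) n).ncard =
      (chains R (r - 1, c + 1) (j + 1) n).ncard + (chains R (r + 1, c + 1) (j + 1) n).ncard +
        (chains R (r, c + 2) j (n - (c + 2))).ncard := by
  have hnot : ∀ (p : ℤ × ℤ) (k : ℕ) (m : ℤ), c + 1 ≤ p.2 → ∀ S ∈ chains R p k m,
      (r, c + 2) ∉ S := by
    intro p k m hp S hS h
    have := column_le_of_mem_cone (hS.1 _ h)
    simp only at this
    omega
  have hinj : Set.InjOn (fun S => insert (r, c + 2) S)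
      (chains R (r, c + 2) j (n - (c + 2))) := by
    intro S hS T hT h
    have hS' := hnot _ _ _ (by simp) S hS
    have hT' := hnot _ _ _ (by simp) T hT
    simpa [erase_insert hS', erase_insert hT'] using
      congrArg (fun U : Finset (ℤ × ℤ) => U.erase (r, c + 2)) h
  have hdisj : Disjoint
      (chains R (r - 1, c + 1) (j + 1) n ∪ chains R (r + 1, c + 1) (j + 1) n)
      ((fun S => insert (r, c + 2) S) '' chains R (r, c + 2) j (n - (c + 2))) := by
    rw [Set.disjoint_left]
    rintro _ hS ⟨T, -, rfl⟩
    rcases hS with hS | hS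
    · exact hnot _ _ _ le_rfl _ hS (mem_insert_self _ _)
    · exact hnot _ _ _ le_rfl _ hS (mem_insert_self _ _)
  rw [chains_succ_eq h1 hR, Set.ncard_union_eq hdisj
    ((chains_finite _ _ _ _).union (chains_finite _ _ _ _)) ((chains_finite _ _ _ _).image _),
    hinj.ncard_image]
  have h := Set.ncard_union_add_ncard_inter (chains R (r - 1, c + 1) (j + 1) n)
    (chains R (r + 1, c + 1) (j + 1) n) (chains_finite _ _ _ _) (chains_finite _ _ _ _)
  rw [chains_inter_chains] at h
  omega

theorem ncard_chains_le {R : ℤ} {p p' : ℤ × ℤ} {e : ℤ × ℤ → ℤ × ℤ} (he : Function.Injective e)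
    (d : ℤ)
    (hcone : ∀ q ∈ cone R p, e q ∈ cone R p')
    (hprec : ∀ a b, Precedes a b ∨ Precedes b a → Precedes (e a) (e b) ∨ Precedes (e b) (e a))
    (hcol : ∀ q, (e q).2 = q.2 + d) (j : ℕ) (n : ℤ) :
    (chains R p j n).ncard ≤ (chains R p' j (n + j * d)).ncard := by
  refine Set.ncard_le_ncard_of_injOn (fun S => S.map ⟨e, he⟩) ?_
    (fun S _ T _ h => Finset.map_injective _ h) (chains_finite _ _ _ _)
  rintro S ⟨hS, hc, hj, hn⟩
  refine ⟨?_, ?_, ?_, ?_⟩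
  · intro q hq
    obtain ⟨q', hq', rfl⟩ := Finset.mem_map.1 hq
    exact hcone q' (hS q' hq')
  · intro a ha b hb hab
    obtain ⟨a', ha', rfl⟩ := Finset.mem_map.1 ha
    obtain ⟨b', hb', rfl⟩ := Finset.mem_map.1 hb
    exact hprec a' b' (hc a' ha' b' hb' fun h => hab (by rw [h]))
  · rw [card_map, hj]
  · simp only [sum_map, Function.Embedding.coeFn_mk, hcol, sum_add_distrib, hn, sum_const, hj,
      nsmul_eq_mul]

theorem ncard_chains_translate (R r c d : ℤ) (j : ℕ) (n : ℤ) :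
    (chains R (r, c + d) j n).ncard = (chains R (r, c) j (n - j * d)).ncard := by
  have shift : ∀ c d : ℤ, ∀ n, (chains R (r, c) j n).ncard ≤
      (chains R (r, c + d) j (n + j * d)).ncard := by
    intro c d n
    refine ncard_chains_le (e := fun q => (q.1, q.2 + d)) (fun q q' h => ?_) d ?_ ?_
      (fun q => rfl) j n
    · simp only [Prod.mk.injEq, add_left_inj] at h
      exact Prod.ext h.1 h.2
    · intro q hq
      simp only [cone, Precedes, Set.mem_ofPred_eq, Int.even_iff] at *
      omega
    · intro a b h
      simp only [Precedes] at *
      omega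
  apply le_antisymm
  · have := shift (c + d) (-d) n
    rwa [add_neg_cancel_right, mul_neg, ← sub_eq_add_neg] at this
  · have := shift c d (n - j * d)
    rwa [sub_add_cancel] at this

theorem ncard_chains_reflect (R r c : ℤ) (j : ℕ) (n : ℤ) :
    (chains R (R + 1 - r, c) j n).ncard = (chains R (r, c) j n).ncard := by
  have flip : ∀ r : ℤ, (chains R (r, c) j n).ncard ≤ (chains R (R + 1 - r, c) j n).ncard := by
    intro r
    have := ncard_chains_le (R := R) (p := (r, c)) (p' := (R + 1 - r, c))
      (e := fun q => (R + 1 - q.1, q.2)) (fun q q' h => ?_) 0 ?_ ?_ (fun q => (add_zero _).symm) j n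
    · simpa using this
    · simp only [Prod.mk.injEq, sub_right_inj] at h
      exact Prod.ext h.1 h.2
    · intro q hq
      simp only [cone, Precedes, Set.mem_ofPred_eq, Int.even_iff] at *
      omega
    · intro a b h
      simp only [Precedes] at *
      omega
  apply le_antisymm
  · have := flip (R + 1 - r)
    rwa [sub_sub_cancel] at this
  · exact flip r

/-- The generating function of the chains of `j` points to the right of the point `(r, -1)`. -/
noncomputable def chainSeries (R r : ℤ) (j : ℕ) : ℤ⟦X⟧ :=
  PowerSeries.mk fun n => ((chains R (r, -1) j n).ncard : ℤ)

theorem coeff_X_pow_mul_chainSeries (R r : ℤ) (j d n : ℕ) :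
    coeff n ((X : ℤ⟦X⟧) ^ d * chainSeries R r j) = (chains R (r, -1) j ((n : ℤ) - d)).ncard := by
  rw [coeff_X_pow_mul']
  split_ifs with h
  · rw [chainSeries, coeff_mk, Nat.cast_sub h]
  · rw [chains_eq_empty_of_neg (by omega)]
    simp

theorem chainSeries_zero (R r : ℤ) : chainSeries R r 0 = 1 := by
  ext n
  rw [chainSeries, coeff_mk, coeff_one]
  have : chains R (r, -1) 0 n = if n = 0 then {∅} else ∅ := by
    ext S
    split_ifs with h
    · subst h
      simp only [chains, Set.mem_ofPred_eq, card_eq_zero, Set.mem_singleton_iff]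
      constructor
      · rintro ⟨-, -, h, -⟩
        exact h
      · rintro rfl
        simp
    · simp only [chains, Set.mem_ofPred_eq, card_eq_zero, Set.mem_empty_iff_false, iff_false]
      rintro ⟨-, -, rfl, h'⟩
      simp at h'
      omega
  rw [this]
  split_ifs <;> simp

theorem chainSeries_recurrence {R r : ℤ} (h1 : 1 ≤ r) (hR : r ≤ R) (N : ℕ) :
    (1 + X ^ (2 * N + 2)) * chainSeries R r (N + 1) =
      X ^ (N + 1) * (chainSeries R (r - 1) (N + 1) + chainSeries R (r + 1) (N + 1)) +
        X ^ (2 * N + 1) * chainSeries R r N := by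
  ext n
  have h := ncard_chains_succ h1 hR (-1) N n
  rw [ncard_chains_translate R r (-1) 2, ncard_chains_translate R r (-1) 2,
    ncard_chains_translate R (r - 1) (-1) 1, ncard_chains_translate R (r + 1) (-1) 1] at h
  simp only [add_mul, mul_add, one_mul, map_add, coeff_X_pow_mul_chainSeries]
  rw [chainSeries, coeff_mk]
  push_cast at h ⊢
  have e1 : (n : ℤ) - (2 * N + 2) = n - (N + 1) * 2 := by ring
  have e2 : (n : ℤ) - (2 * N + 1) = n - (-1 + 2) - N * 2 := by ring
  have e3 : (n : ℤ) - (N + 1) = n - (N + 1) * 1 := by ring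
  rw [e1, e2, e3]
  exact_mod_cast h

theorem chainSeries_satisfiesRecurrence {ℓ : ℕ} (hℓ : 1 ≤ ℓ) :
    SatisfiesRecurrence ℓ (fun i => chainSeries (2 * ℓ - 1) i) := by
  refine ⟨fun i _ => chainSeries_zero _ _, fun N => ?_, fun i hi N => ?_, fun i hi N => ?_⟩
  · ext n
    have hc : cone (2 * ℓ - 1) (0, -1) = cone (2 * ℓ - 1) (1, -1 + 1) := by
      ext q
      simp only [cone, Precedes, Set.mem_ofPred_eq, Int.even_iff]
      omega
    rw [coeff_X_pow_mul_chainSeries, chainSeries, coeff_mk, Nat.cast_zero, Nat.cast_one,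
      chains_congr hc, ncard_chains_translate, mul_one]
  · have := chainSeries_recurrence (R := 2 * ℓ - 1) (r := i + 1) (by omega) (by omega) N
    rw [add_sub_cancel_right, add_assoc (i : ℤ) 1 1] at this
    exact_mod_cast this
  · have := chainSeries_recurrence (R := 2 * ℓ - 1) (r := i + 1) (by omega) (by omega) N
    have hr : chainSeries (2 * ℓ - 1) (i + 1 + 1) (N + 1) =
        chainSeries (2 * ℓ - 1) i (N + 1) := by
      ext n
      rw [chainSeries, chainSeries, coeff_mk, coeff_mk, ← ncard_chains_reflect _ (i : ℤ)]
      congr 4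
      rw [← hi]
      push_cast
      ring
    rw [add_sub_cancel_right, hr, ← two_mul] at this
    exact_mod_cast this

/-! ### Admissible colored partitions as chains -/

/-- A part of the array as a lattice point (row, column). -/
def partPoint : ℕ × ℕ ↪ ℤ × ℤ :=
  ⟨fun p => (p.1, p.2), fun p q h => by
    simp only [Prod.mk.injEq, Nat.cast_inj] at h
    exact Prod.ext h.1 h.2⟩

theorem partPoint_apply (p : ℕ × ℕ) : partPoint p = ((p.1 : ℤ), (p.2 : ℤ)) := rfl

/-- Two positions neither of which precedes the other lie on a common downward path: the lower
envelope of the two upward cones of slope `1`. -/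
theorem exists_isDownwardPath {t ℓ r r' : ℕ} {c c' : ℤ} (h : IsPosition t ℓ r c)
    (h' : IsPosition t ℓ r' c') (hp : ¬ Precedes (r, c) (r', c'))
    (hp' : ¬ Precedes (r', c') (r, c)) :
    ∃ Z, IsDownwardPath t ℓ Z ∧ Z r = c ∧ Z r' = c' := by
  simp only [Precedes, IsPosition, Int.odd_iff] at *
  refine ⟨fun x => min (c + ((x : ℤ) - r).natAbs) (c' + ((x : ℤ) - r').natAbs),
    ⟨fun x h1 h2 => ?_, fun x h1 h2 => ?_⟩, ?_, ?_⟩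
  · simp only [IsPosition, Int.odd_iff]
    omega
  · beta_reduce
    omega
  · beta_reduce
    omega
  · beta_reduce
    omega

theorem IsDownwardPath.natAbs_sub_le {t ℓ : ℕ} {Z : ℕ → ℤ} (hZ : IsDownwardPath t ℓ Z) {r : ℕ}
    (hr : 1 ≤ r) (d : ℕ) (hd : r + d ≤ 2 * ℓ - 1) : (Z (r + d) - Z r).natAbs ≤ d := by
  induction d with
  | zero => simp
  | succ d ih =>
    have h1 := ih (by omega)
    have h2 := hZ.2 (r + d) (by omega) (by omega)
    rw [← add_assoc]
    omega

/-- Positions on a downward path do not precede one another. -/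
theorem IsDownwardPath.not_precedes {t ℓ : ℕ} {Z : ℕ → ℤ} (hZ : IsDownwardPath t ℓ Z) {r r' : ℕ}
    (hr : 1 ≤ r) (hr2 : r ≤ 2 * ℓ - 1) (hr' : 1 ≤ r') (hr2' : r' ≤ 2 * ℓ - 1) :
    ¬ Precedes (r, Z r) (r', Z r') := by
  simp only [Precedes]
  rcases le_total r r' with h | h
  · obtain ⟨d, rfl⟩ := Nat.exists_eq_add_of_le h
    have := hZ.natAbs_sub_le hr d hr2'
    push_cast
    omega
  · obtain ⟨d, rfl⟩ := Nat.exists_eq_add_of_le h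
    have := hZ.natAbs_sub_le hr' d hr2
    push_cast
    omega

/-- The row of the initial position with entry `1`. -/
def originRow (i : ℕ) : ℕ := max i 1

/-- The column of the initial position with entry `1`. -/
def originColumn (i : ℕ) : ℤ := if i = 0 then 0 else -1

theorem isPosition_origin {ℓ i : ℕ} (hℓ : 1 ≤ ℓ) (hi : i ≤ ℓ) :
    IsPosition (firstPart i) ℓ (originRow i) (originColumn i) := by
  simp only [IsPosition, firstPart, originRow, originColumn, Int.odd_iff, Nat.even_iff]
  split_ifs <;> omega

theorem entry_of_pos (t ℓ : ℕ) (k : ℕ → ℕ) (π : Multiset (ℕ × ℕ)) (r : ℕ) {m : ℕ} (hm : 1 ≤ m) :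
    entry t ℓ k π r m = π.count (r, m) := by
  rw [entry, if_neg (by omega), Int.toNat_natCast]

theorem entry_origin {ℓ i : ℕ} (hi : i ≤ ℓ) (π : Multiset (ℕ × ℕ)) :
    entry (firstPart i) ℓ (unitInitial i) π (originRow i) (originColumn i) = 1 := by
  rcases Nat.eq_zero_or_pos i with rfl | h
  · simp [entry, originRow, originColumn, initialEntry, firstPart, unitInitial,
      show ¬ Even (2 + 1) by decide]
  · have h1 : originRow i = i := by simp only [originRow]; omega
    have h2 : Even (firstPart i + i) := by
      simp only [firstPart, Nat.even_iff]
      split_ifs <;> omega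
    rw [entry, if_pos (by simp only [originColumn]; split_ifs <;> omega), h1, initialEntry,
      if_pos h2, if_pos hi, unitInitial, if_pos rfl]

theorem eq_origin_of_initialEntry_ne_zero {ℓ i r : ℕ} {c : ℤ}
    (hp : IsPosition (firstPart i) ℓ r c) (hc : c ≤ 0)
    (h : initialEntry (firstPart i) ℓ (unitInitial i) r ≠ 0) :
    r = originRow i ∧ c = originColumn i := by
  obtain ⟨h1, -, h2, h3⟩ := hp
  simp only [initialEntry, unitInitial, firstPart, originRow, originColumn, Int.odd_iff,
    Nat.even_iff] at *
  split_ifs at * <;> omega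

theorem initialEntry_unitInitial_le_one (t ℓ i r : ℕ) :
    initialEntry t ℓ (unitInitial i) r ≤ 1 := by
  simp only [initialEntry, unitInitial]
  split_ifs <;> omega

theorem sum_unitInitial {ℓ i : ℕ} (hi : i ≤ ℓ) :
    ∑ m ∈ Finset.range (ℓ + 1), unitInitial i m = 1 := by
  simp [unitInitial, hi]

/-- The cone of `(i, -1)` is that of the origin. For `i = 0` its apex lies one row above the
array. -/
theorem mem_cone_iff {ℓ i : ℕ} (hℓ : 1 ≤ ℓ) (p : ℕ × ℕ) :
    partPoint p ∈ cone (2 * ℓ - 1) (i, -1) ↔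
      IsPart (firstPart i) ℓ p ∧ Precedes (originRow i, originColumn i) (partPoint p) := by
  simp only [cone, Precedes, partPoint_apply, Set.mem_ofPred_eq, IsPart,
    IsPosition, firstPart, originRow, originColumn, Int.odd_iff, Int.even_iff, Nat.even_iff]
  split_ifs <;> push_cast <;> omega

theorem isAdmissible_iff {ℓ i : ℕ} (hℓ : 1 ≤ ℓ) (hi : i ≤ ℓ) (π : Multiset (ℕ × ℕ)) :
    IsAdmissible (firstPart i) ℓ (unitInitial i) π ↔
      π.Nodup ∧ (∀ p ∈ π, partPoint p ∈ cone (2 * ℓ - 1) (i, -1)) ∧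
        ∀ p ∈ π, ∀ q ∈ π, p ≠ q → Precedes (partPoint p) (partPoint q) ∨
          Precedes (partPoint q) (partPoint p) := by
  constructor
  · rintro ⟨hpart, hpath⟩
    rw [sum_unitInitial hi] at hpath
    have one : ∀ r c, IsPosition (firstPart i) ℓ r c →
        entry (firstPart i) ℓ (unitInitial i) π r c ≤ 1 := by
      intro r c h
      have hn : ¬ Precedes (r, c) (r, c) := by simp [Precedes]
      obtain ⟨Z, hZ, hr, -⟩ := exists_isDownwardPath h h hn hn
      refine le_trans ?_ (hpath Z hZ)
      conv_lhs => rw [← hr]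
      exact single_le_sum
        (f := fun r => entry (firstPart i) ℓ (unitInitial i) π r (Z r))
        (fun _ _ => Nat.zero_le _) (Finset.mem_Icc.2 ⟨h.1, h.2.1⟩)
    have two : ∀ r c r' c', IsPosition (firstPart i) ℓ r c → IsPosition (firstPart i) ℓ r' c' →
        ¬ (r = r' ∧ c = c') → 1 ≤ entry (firstPart i) ℓ (unitInitial i) π r c →
        1 ≤ entry (firstPart i) ℓ (unitInitial i) π r' c' →
        Precedes (r, c) (r', c') ∨ Precedes (r', c') (r, c) := by
      intro r c r' c' h h' hne he he'
      by_contra hcon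
      rw [not_or] at hcon
      obtain ⟨Z, hZ, hr, hr'⟩ := exists_isDownwardPath h h' hcon.1 hcon.2
      have hrr : r ≠ r' := by
        rintro rfl
        exact hne ⟨rfl, by rw [← hr, ← hr']⟩
      have := (sum_le_sum_of_subset (f := fun r => entry (firstPart i) ℓ (unitInitial i) π r (Z r))
        (s := {r, r'}) (t := Finset.Icc 1 (2 * ℓ - 1)) (by
          intro x hx
          rcases Finset.mem_insert.1 hx with rfl | hx
          · exact Finset.mem_Icc.2 ⟨h.1, h.2.1⟩
          · rw [Finset.mem_singleton.1 hx]
            exact Finset.mem_Icc.2 ⟨h'.1, h'.2.1⟩)).trans (hpath Z hZ)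
      rw [sum_pair hrr, hr, hr'] at this
      omega
    have hentry : ∀ p ∈ π, 1 ≤ entry (firstPart i) ℓ (unitInitial i) π p.1 p.2 := by
      intro p hp
      rw [entry_of_pos _ _ _ _ _ (hpart p hp).1]
      exact Multiset.one_le_count_iff_mem.2 hp
    refine ⟨?_, ?_, ?_⟩
    · rw [Multiset.nodup_iff_count_le_one]
      intro p
      by_cases hp : p ∈ π
      · have := one p.1 p.2 (hpart p hp).2
        rwa [entry_of_pos _ _ _ _ _ (hpart p hp).1] at this
      · rw [Multiset.count_eq_zero_of_notMem hp]
        exact Nat.zero_le _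
    · intro p hp
      rw [mem_cone_iff hℓ]
      have hcol : originColumn i ≤ 0 := by
        simp only [originColumn]
        split_ifs <;> omega
      have hp1 := (hpart p hp).1
      refine ⟨hpart p hp, (two _ _ _ _ (isPosition_origin hℓ hi) (hpart p hp).2 ?_
        (entry_origin hi π).ge (hentry p hp)).resolve_right ?_⟩
      · rintro ⟨-, h⟩
        omega
      · rintro ⟨h1, h2⟩
        simp only at h1 h2
        omega
    · intro p hp q hq hpq
      exact two _ _ _ _ (hpart p hp).2 (hpart q hq).2
        (fun h => hpq (Prod.ext h.1 (Int.ofNat_inj.1 h.2))) (hentry p hp) (hentry q hq)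
  · rintro ⟨hnodup, hcone, hsep⟩
    have hcone' := fun p hp => (mem_cone_iff hℓ p).1 (hcone p hp)
    refine ⟨fun p hp => (hcone' p hp).1, fun Z hZ => ?_⟩
    rw [sum_unitInitial hi]
    have hle : ∀ r c, entry (firstPart i) ℓ (unitInitial i) π r c ≤ 1 := by
      intro r c
      rw [entry]
      split_ifs
      · exact initialEntry_unitInitial_le_one _ _ _ _
      · exact Multiset.nodup_iff_count_le_one.1 hnodup _
    have hmem : ∀ r, 1 ≤ r → r ≤ 2 * ℓ - 1 →
        entry (firstPart i) ℓ (unitInitial i) π r (Z r) ≠ 0 →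
        (r = originRow i ∧ Z r = originColumn i) ∨ ∃ p ∈ π, r = p.1 ∧ Z r = p.2 := by
      intro r h1 h2 h
      rw [entry] at h
      split_ifs at h with hc
      · exact Or.inl (eq_origin_of_initialEntry_ne_zero (hZ.1 r h1 h2) hc h)
      · exact Or.inr ⟨_, Multiset.count_ne_zero.1 h, rfl, by simp only; omega⟩
    have huniq : ∀ r r', 1 ≤ r → r ≤ 2 * ℓ - 1 → 1 ≤ r' → r' ≤ 2 * ℓ - 1 →
        entry (firstPart i) ℓ (unitInitial i) π r (Z r) ≠ 0 →
        entry (firstPart i) ℓ (unitInitial i) π r' (Z r') ≠ 0 → r = r' := by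
      intro r r' h1 h2 h1' h2' h h'
      by_contra hne
      have n1 := hZ.not_precedes h1 h2 h1' h2'
      have n2 := hZ.not_precedes h1' h2' h1 h2
      rcases hmem r h1 h2 h with ⟨e1, e2⟩ | ⟨p, hp, e1, e2⟩ <;>
        rcases hmem r' h1' h2' h' with ⟨e1', e2'⟩ | ⟨p', hp', e1', e2'⟩
      · exact hne (e1.trans e1'.symm)
      · rw [e2, e2', e1, e1'] at n1
        exact n1 (hcone' p' hp').2
      · rw [e2, e2', e1, e1'] at n2
        exact n2 (hcone' p hp).2
      · rw [e2, e2', e1, e1'] at n1 n2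
        rcases hsep p hp p' hp' (fun hpp => hne (by rw [e1, e1', hpp])) with h | h
        · exact n1 h
        · exact n2 h
    by_cases hz : ∀ r ∈ Finset.Icc 1 (2 * ℓ - 1),
        entry (firstPart i) ℓ (unitInitial i) π r (Z r) = 0
    · rw [sum_eq_zero hz]
      exact Nat.zero_le _
    · push Not at hz
      obtain ⟨r, hr, hr0⟩ := hz
      rw [sum_eq_single_of_mem r hr]
      · exact hle _ _
      · intro r' hr' hne
        by_contra h0
        rw [Finset.mem_Icc] at hr hr'
        exact hne (huniq r' r hr'.1 hr'.2 hr.1 hr.2 h0 hr0)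

theorem Fstar_eq_ncard_chains {ℓ i : ℕ} (hℓ : 1 ≤ ℓ) (hi : i ≤ ℓ) (j n : ℕ) :
    Fstar ℓ i j n = (chains (2 * ℓ - 1) (i, -1) j n).ncard := by
  unfold Fstar
  refine Set.ncard_congr (fun π _ => π.toFinset.map partPoint) ?_ ?_ ?_
  · rintro π ⟨hπ, hj, hn⟩
    obtain ⟨h1, h2, h3⟩ := (isAdmissible_iff hℓ hi π).1 hπ
    refine ⟨?_, ?_, ?_, ?_⟩
    · intro q hq
      obtain ⟨p, hp, rfl⟩ := Finset.mem_map.1 hq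
      exact h2 p (Multiset.mem_toFinset.1 hp)
    · intro a ha b hb hab
      obtain ⟨a', ha', rfl⟩ := Finset.mem_map.1 ha
      obtain ⟨b', hb', rfl⟩ := Finset.mem_map.1 hb
      exact h3 a' (Multiset.mem_toFinset.1 ha') b' (Multiset.mem_toFinset.1 hb')
        fun h => hab (by rw [h])
    · rw [card_map, Multiset.toFinset_card_of_nodup h1, hj]
    · rw [sum_map, ← hn, Finset.sum, Multiset.toFinset_val, h1.dedup]
      simp [partPoint_apply]
  · rintro π π' ⟨hπ, -⟩ ⟨hπ', -⟩ h
    have h1 := ((isAdmissible_iff hℓ hi π).1 hπ).1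
    have h1' := ((isAdmissible_iff hℓ hi π').1 hπ').1
    have := congrArg Finset.val (Finset.map_injective partPoint h)
    rwa [Multiset.toFinset_val, Multiset.toFinset_val, h1.dedup, h1'.dedup] at this
  · rintro S ⟨h2, h3, hj, hn⟩
    have hex : ∃ T : Finset (ℕ × ℕ), T.map partPoint = S := by
      refine ⟨S.image fun q => (q.1.toNat, q.2.toNat), ?_⟩
      rw [Finset.map_eq_image, Finset.image_image]
      conv_rhs => rw [← Finset.image_id (s := S)]
      refine Finset.image_congr fun q hq => ?_
      have g1 := (h2 q hq).1
      have g2 := column_le_of_mem_cone (h2 q hq)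
      simp only at g2
      simp only [partPoint_apply, Function.comp_apply, id]
      exact Prod.ext (Int.toNat_of_nonneg (by omega)) (Int.toNat_of_nonneg (by omega))
    obtain ⟨T, rfl⟩ := hex
    refine ⟨T.val, ⟨(isAdmissible_iff hℓ hi _).2 ⟨T.nodup, ?_, ?_⟩, ?_, ?_⟩, ?_⟩
    · exact fun p hp => h2 _ (Finset.mem_map_of_mem _ hp)
    · exact fun p hp q hq hpq => h3 _ (Finset.mem_map_of_mem _ hp) _ (Finset.mem_map_of_mem _ hq)
        (partPoint.injective.ne hpq)
    · rw [← hj, card_map]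
      rfl
    · rw [sum_map] at hn
      have : ((∑ p ∈ T, p.2 : ℕ) : ℤ) = n := by
        rw [← hn]
        simp [partPoint_apply]
      exact_mod_cast this
    · rw [Finset.val_toFinset]

theorem Pstar_eq {ℓ i : ℕ} (hℓ : 1 ≤ ℓ) (hi : i ≤ ℓ) :
    Pstar ℓ i = PowerSeries.mk (chainSeries (2 * ℓ - 1) i) := by
  unfold Pstar chainSeries
  simp only [Fstar_eq_ncard_chains hℓ hi]

theorem Pstar_eq_mk_multisum {ℓ i : ℕ} (hℓ : 1 ≤ ℓ) (hi : i ≤ ℓ) :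
    Pstar ℓ i = PowerSeries.mk (multisum ℓ i) := by
  obtain ⟨m, rfl⟩ : ∃ m, ℓ = m + 1 := ⟨ℓ - 1, by omega⟩
  rw [Pstar_eq hℓ hi]
  congr 1
  funext N
  exact (chainSeries_satisfiesRecurrence hℓ).unique hℓ (multisum_satisfiesRecurrence m) N i hi

end CMPP

/-- Infinite sums of formal power series are taken coefficientwise (in the product topology, with
the discrete topology on `ℤ`). -/
theorem theorem1p6 (ℓ : ℕ) (hℓ : 2 ≤ ℓ) (i : ℕ) (hi : i ≤ ℓ) :
    HasSum (fun n : Fin ℓ → ℕ => CMPP.summand ℓ i n) (CMPP.Pstar ℓ i) := by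
  rw [CMPP.Pstar_eq_mk_multisum (by omega) hi]
  exact CMPP.hasSum_summand ℓ i
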